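/- Let $\ell_\infty$ be the complex Banach space of bounded complex sequences with the supremum norm, and let $P:\ell_\infty\to\mathbb{C}$ be a non-zero continuous $2$-homogeneous polynomial, that is, $P(x)=A(x,x)$ for a symmetric bilinear form $A:\ell_\infty\times\ell_\infty\to\mathbb{C}$, and there is a constant $k$ with $|P(x)|\le k\|x\|^2$ for all $x$. Then there is a non-separable $P$-maximal subspace $M$ of $\ell_\infty$. Here a proper complex linear subspace $M\subsetneq \ell_\infty$ is called $P$-maximal if $P|_M=0$ and every linear subspace $M_1$ of $\ell_\infty$ with $M\subset M_1$ and $P|_{M_1}=0$ is equal to $M$. -/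

import Mathlib

open scoped ENNReal

/-- `P : X → 𝕜` is a continuous `n`-homogeneous polynomial: it is the restriction to the diagonal
of a symmetric `n`-linear form, and `|P x| ≤ k ‖x‖ ^ n` for some constant `k`. -/
def IsContHomogeneousPolynomial {𝕜 X : Type*} [RCLike 𝕜] [NormedAddCommGroup X] [NormedSpace 𝕜 X]
    (n : ℕ) (P : X → 𝕜) : Prop :=
  (∃ A : MultilinearMap 𝕜 (fun _ : Fin n => X) 𝕜,
    (∀ (σ : Equiv.Perm (Fin n)) (v : Fin n → X), A (fun i => v (σ i)) = A v) ∧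
    ∀ x : X, P x = A (fun _ => x)) ∧
  ∃ k : ℝ, ∀ x : X, ‖P x‖ ≤ k * ‖x‖ ^ n

/-- A linear subspace `M` of `X` is `P`-maximal: it is proper, `P` vanishes on it, and every
linear subspace that contains `M` and on which `P` vanishes is equal to `M`. -/
def IsPMaximal {𝕜 X : Type*} [RCLike 𝕜] [NormedAddCommGroup X] [NormedSpace 𝕜 X]
    (P : X → 𝕜) (M : Submodule 𝕜 X) : Prop :=
  M ≠ ⊤ ∧ (∀ x ∈ M, P x = 0) ∧
    ∀ M₁ : Submodule 𝕜 X, (∀ x ∈ M₁, P x = 0) → M ≤ M₁ → M₁ = M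

/-! Orthogonality and isotropy refer to the symmetric bilinear form B of P. Over ℂ, a maximal
isotropic M has an orthogonal lying in M plus a line (`exists_orthogonal_subset_span`), so if M is
separable, its orthogonal is too. Choose M to contain disjointly supported, mutually orthogonal
isotropic unit vectors u n, and let J be an operator on ℓ∞ taking the unit vectors to the u n. For d
in M the functional B d ∘ J kills every unit vector, hence is non-zero on only countably many
indicators of an almost disjoint family (`countable_map_indicatorSeq_ne_zero`). If M had a countable
dense subset, all but countably many members of an uncountable such family would have J-images
orthogonal to M. These images are 1/2-separated, which contradicts separability. -/

open TopologicalSpace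

/-! ### Isotropic subspaces of a symmetric bilinear form -/

section Quadratic

variable {X : Type*} [AddCommGroup X] [Module ℂ X] (B : X →ₗ[ℂ] X →ₗ[ℂ] ℂ)

/-- Over `ℂ`, every pair of vectors has a non-trivial isotropic linear combination. -/
theorem exists_isotropic_combination (hs : ∀ x y, B x y = B y x) (u v : X) :
    ∃ a b : ℂ, (a ≠ 0 ∨ b ≠ 0) ∧ B (a • u + b • v) (a • u + b • v) = 0 := by
  by_cases hu : B u u = 0
  · exact ⟨1, 0, Or.inl one_ne_zero, by simp [hu]⟩
  · obtain ⟨a, ha⟩ := exists_quadratic_eq_zero (b := 2 * B u v) (c := B v v) hu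
      (IsAlgClosed.exists_eq_mul_self _)
    refine ⟨a, 1, Or.inr one_ne_zero, ?_⟩
    simp only [map_add, map_smul, LinearMap.add_apply, LinearMap.smul_apply, smul_eq_mul, hs v u]
    linear_combination ha

theorem bilin_eq_zero_of_isotropic (hs : ∀ x y, B x y = B y x) {M : Submodule ℂ X}
    (hM : ∀ x ∈ M, B x x = 0) {x y : X} (hx : x ∈ M) (hy : y ∈ M) : B x y = 0 := by
  have h := hM _ (M.add_mem hx hy)
  simp only [map_add, LinearMap.add_apply, hM x hx, hM y hy, hs y x] at h
  linear_combination h / 2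

theorem isotropic_span_range (hs : ∀ x y, B x y = B y x) (u : ℕ → X) (hu : ∀ n, B (u n) (u n) = 0)
    (hlt : ∀ m n, m < n → B (u m) (u n) = 0) :
    ∀ x ∈ Submodule.span ℂ (Set.range u), B x x = 0 := by
  have h0 : ∀ m n, B (u m) (u n) = 0 := by
    intro m n
    rcases lt_trichotomy m n with h | rfl | h
    · exact hlt m n h
    · exact hu m
    · rw [hs]; exact hlt n m h
  have h1 : ∀ n, ∀ y ∈ Submodule.span ℂ (Set.range u), B (u n) y = 0 := by
    intro n
    have : Submodule.span ℂ (Set.range u) ≤ LinearMap.ker (B (u n)) :=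
      Submodule.span_le.2 (by rintro _ ⟨m, rfl⟩; exact h0 n m)
    exact fun y hy => this hy
  intro x hx
  have : Submodule.span ℂ (Set.range u) ≤ LinearMap.ker (B x) :=
    Submodule.span_le.2 (by rintro _ ⟨m, rfl⟩; exact (hs _ _).trans (h1 m x hx))
  exact this hx

theorem exists_maximal_isotropic (M₀ : Submodule ℂ X) (h₀ : ∀ x ∈ M₀, B x x = 0) :
    ∃ M : Submodule ℂ X, M₀ ≤ M ∧ (∀ x ∈ M, B x x = 0) ∧
      ∀ M₁ : Submodule ℂ X, (∀ x ∈ M₁, B x x = 0) → M ≤ M₁ → M₁ = M := by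
  obtain ⟨M, hM, hmax⟩ := zorn_le_nonempty₀ {M : Submodule ℂ X | ∀ x ∈ M, B x x = 0} (by
    intro c hc hchain y hy
    refine ⟨sSup c, fun x hx => ?_, fun z hz => le_sSup hz⟩
    obtain ⟨N, hN, hxN⟩ := (Submodule.mem_sSup_of_directed ⟨y, hy⟩ hchain.directedOn).1 hx
    exact hc hN x hxN) M₀ h₀
  exact ⟨M, hM, hmax.prop, fun M₁ h₁ hle => le_antisymm (hmax.le_of_ge h₁ hle) hle⟩

theorem mem_of_maximal_isotropic (hs : ∀ x y, B x y = B y x) {M : Submodule ℂ X}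
    (hM : ∀ x ∈ M, B x x = 0)
    (hmax : ∀ M₁ : Submodule ℂ X, (∀ x ∈ M₁, B x x = 0) → M ≤ M₁ → M₁ = M)
    {w : X} (hw : ∀ m ∈ M, B m w = 0) (hww : B w w = 0) : w ∈ M := by
  have h := hmax (M ⊔ Submodule.span ℂ {w}) (by
    intro x hx
    obtain ⟨m, hm, z, hz, rfl⟩ := Submodule.mem_sup.1 hx
    obtain ⟨c, rfl⟩ := Submodule.mem_span_singleton.1 hz
    simp [hM m hm, hw m hm, hww, hs w m]) le_sup_left
  rw [← h]
  exact (le_sup_right : _ ≤ M ⊔ Submodule.span ℂ {w}) (Submodule.mem_span_singleton_self w)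

/-- The orthogonal of a maximal isotropic subspace exceeds it by at most one dimension. -/
theorem exists_orthogonal_subset_span (hs : ∀ x y, B x y = B y x) {M : Submodule ℂ X}
    (hM : ∀ x ∈ M, B x x = 0)
    (hmax : ∀ M₁ : Submodule ℂ X, (∀ x ∈ M₁, B x x = 0) → M ≤ M₁ → M₁ = M) :
    ∃ u₀ : X, ∀ v, (∀ m ∈ M, B m v = 0) → v ∈ M ⊔ Submodule.span ℂ {u₀} := by
  by_cases h : ∃ u₀, (∀ m ∈ M, B m u₀ = 0) ∧ u₀ ∉ M
  · obtain ⟨u₀, hu₀, hu₀M⟩ := h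
    refine ⟨u₀, fun v hv => ?_⟩
    obtain ⟨a, b, hab, h0⟩ := exists_isotropic_combination B hs u₀ v
    have hmem : a • u₀ + b • v ∈ M :=
      mem_of_maximal_isotropic B hs hM hmax (fun m hm => by simp [hu₀ m hm, hv m hm]) h0
    have hb : b ≠ 0 := by
      rintro rfl
      have ha : a ≠ 0 := by simpa using hab
      exact hu₀M ((M.smul_mem_iff ha).1 (by simpa using hmem))
    have hv' : v = b⁻¹ • (a • u₀ + b • v) + (-(b⁻¹ * a)) • u₀ := by
      rw [smul_add, smul_smul, smul_smul, inv_mul_cancel₀ hb]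
      module
    rw [hv']
    exact Submodule.add_mem_sup (M.smul_mem _ hmem)
      (Submodule.smul_mem _ _ (Submodule.mem_span_singleton_self u₀))
  · push Not at h
    exact ⟨0, fun v hv => (le_sup_left : M ≤ _) (h v hv)⟩

/-- Finitely many linear conditions leave a non-zero isotropic vector in the span of a sufficiently
large linearly independent family. -/
theorem exists_isotropic_in_span (hs : ∀ x y, B x y = B y x) (s : Finset X)
    (g : (Fin (s.card + 2) → ℂ) →ₗ[ℂ] X) :
    ∃ c : Fin (s.card + 2) → ℂ, c ≠ 0 ∧ B (g c) (g c) = 0 ∧ ∀ x ∈ s, B x (g c) = 0 := by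
  let L : (Fin (s.card + 2) → ℂ) →ₗ[ℂ] (s → ℂ) := LinearMap.pi fun x => (B x).comp g
  have hr := L.finrank_range_add_finrank_ker
  have hle : Module.finrank ℂ (LinearMap.range L) ≤ s.card := by
    simpa using Submodule.finrank_le (LinearMap.range L)
  -- The 2 in `s.card + 2` leaves a kernel of dimension at least two, and any two independent
  -- vectors have a non-trivial isotropic combination.
  have hker : 1 < Module.finrank ℂ (LinearMap.ker L) := by
    rw [Module.finrank_fin_fun] at hr
    omega
  have : Nontrivial (LinearMap.ker L) := Module.nontrivial_of_finrank_pos (R := ℂ) (by omega)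
  obtain ⟨u, hu⟩ := exists_ne (0 : LinearMap.ker L)
  obtain ⟨v, huv⟩ := exists_linearIndependent_pair_of_one_lt_finrank hker hu
  obtain ⟨a, b, hab, h0⟩ := exists_isotropic_combination B hs (g u) (g v)
  refine ⟨((a • u + b • v : LinearMap.ker L) : Fin (s.card + 2) → ℂ), fun h => ?_, by simpa using h0,
    fun x hx => ?_⟩
  · have := LinearIndependent.pair_iff.1 huv a b (Subtype.ext h)
    tauto
  · exact congrFun (LinearMap.mem_ker.1 (a • u + b • v : LinearMap.ker L).2) ⟨x, hx⟩

end Quadratic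

/-! ### Separated families and almost disjoint branches -/

section SeparatedFamilies

theorem Set.Countable.of_separated_of_isSeparable {X ι : Type*} [PseudoMetricSpace X] {s : Set X}
    (hs : IsSeparable s) {G : Set ι} (y : ι → X) (hy : ∀ i ∈ G, y i ∈ s) {ε : ℝ} (hε : 0 < ε)
    (hsep : ∀ i ∈ G, ∀ j ∈ G, i ≠ j → ε ≤ dist (y i) (y j)) : G.Countable := by
  obtain ⟨c, hc, hcs⟩ := hs
  have h : ∀ i : G, ∃ d : c, dist (y i) d < ε / 2 := fun i => by
    obtain ⟨d, hd, hdist⟩ := Metric.mem_closure_iff.1 (hcs (hy i i.2)) (ε / 2) (half_pos hε)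
    exact ⟨⟨d, hd⟩, hdist⟩
  choose f hf using h
  have : Countable c := hc
  have hinj : Function.Injective f := by
    intro i j hij
    by_contra hne
    have h1 := hsep i i.2 j j.2 (fun h => hne (Subtype.ext h))
    have h2 := dist_triangle_right (y i) (y j) (f i)
    have h3 := hf i
    have h4 := hf j
    rw [← hij] at h4
    linarith
  exact hinj.countable

/-- The set of codes of the initial segments of a binary sequence. -/
def branch (g : ℕ → Bool) : Set ℕ :=
  Set.range fun n : ℕ => Encodable.encode ((List.range n).map g)

theorem encode_map_range_injective (g h : ℕ → Bool) {m n : ℕ}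
    (e : Encodable.encode ((List.range m).map g) = Encodable.encode ((List.range n).map h)) :
    m = n ∧ ∀ i < m, g i = h i := by
  have e' := Encodable.encode_injective e
  have hl : m = n := by simpa using congrArg List.length e'
  subst hl
  refine ⟨rfl, fun i hi => ?_⟩
  simpa using List.map_inj_left.1 e' i (List.mem_range.2 hi)

theorem branch_infinite (g : ℕ → Bool) : (branch g).Infinite :=
  Set.infinite_range_of_injective fun _ _ e => (encode_map_range_injective g g e).1

/-- Sequences that differ at k share only initial segments of length at most k. -/
theorem branch_inter_finite {g h : ℕ → Bool} (hne : g ≠ h) : (branch g ∩ branch h).Finite := by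
  obtain ⟨k, hk⟩ := Function.ne_iff.1 hne
  refine ((Set.finite_Iic k).image fun n => Encodable.encode ((List.range n).map g)).subset ?_
  rintro _ ⟨⟨m, rfl⟩, ⟨n, hn⟩⟩
  obtain ⟨-, h2⟩ := encode_map_range_injective g h hn.symm
  refine ⟨m, ?_, rfl⟩
  by_contra hm
  exact hk (h2 k (by simpa using hm))

theorem not_countable_binary_sequences : ¬ (Set.univ : Set (ℕ → Bool)).Countable := by
  rw [← Cardinal.le_aleph0_iff_set_countable, Cardinal.mk_univ]
  simp [Cardinal.aleph0_lt_continuum]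

end SeparatedFamilies

/-! ### Functionals and block sequences in ℓ∞ -/

section BoundedSequences

local notation "ℓ∞" => lp (fun _ : ℕ => ℂ) ∞

/-- The element of `ℓ∞` with given bounded coordinates. -/
def boundedSeq (f : ℕ → ℂ) (C : ℝ) (hf : ∀ k, ‖f k‖ ≤ C) : ℓ∞ :=
  ⟨f, memℓp_infty ⟨C, by rintro _ ⟨k, rfl⟩; exact hf k⟩⟩

@[simp] theorem boundedSeq_apply (f : ℕ → ℂ) (C : ℝ) (hf : ∀ k, ‖f k‖ ≤ C) (k : ℕ) :
    boundedSeq f C hf k = f k := rfl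

open Classical in
/-- The indicator sequence of a set of natural numbers. -/
noncomputable def indicatorSeq (S : Set ℕ) : ℓ∞ :=
  boundedSeq (fun k => if k ∈ S then 1 else 0) 1 fun k => by split_ifs <;> simp

open Classical in
@[simp] theorem indicatorSeq_apply (S : Set ℕ) (k : ℕ) :
    indicatorSeq S k = if k ∈ S then 1 else 0 := rfl

/-- The weighted composition operator `c ↦ (w k * c (π k))ₖ`. -/
noncomputable def weightedComp (w : ℕ → ℂ) (hw : ∀ k, ‖w k‖ ≤ 1) (π : ℕ → ℕ) : ℓ∞ →L[ℂ] ℓ∞ :=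
  LinearMap.mkContinuous
    { toFun := fun c => boundedSeq (fun k => w k * c (π k)) ‖c‖ fun k => by
        rw [norm_mul]
        exact (mul_le_mul (hw k) (lp.norm_apply_le_norm ENNReal.top_ne_zero c _)
          (norm_nonneg _) zero_le_one).trans_eq (one_mul _)
      map_add' := fun c d => by
        ext k
        simp [mul_add]
      map_smul' := fun a c => by
        ext k
        simp [mul_left_comm] } 1 fun c => by
    rw [one_mul]
    refine lp.norm_le_of_forall_le (norm_nonneg _) fun k => ?_
    simp only [LinearMap.coe_mk, AddHom.coe_mk, boundedSeq_apply, norm_mul]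
    exact (mul_le_mul (hw k) (lp.norm_apply_le_norm ENNReal.top_ne_zero c _)
      (norm_nonneg _) zero_le_one).trans_eq (one_mul _)

@[simp] theorem weightedComp_apply (w : ℕ → ℂ) (hw : ∀ k, ‖w k‖ ≤ 1) (π : ℕ → ℕ) (c : ℓ∞) (k : ℕ) :
    weightedComp w hw π c k = w k * c (π k) := rfl

theorem map_indicatorSeq_finset (f : ℓ∞ →L[ℂ] ℂ) (hf : ∀ n, f (indicatorSeq {n}) = 0)
    {F : Set ℕ} (hF : F.Finite) : f (indicatorSeq F) = 0 := by
  classical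
  have : indicatorSeq F = ∑ n ∈ hF.toFinset, indicatorSeq {n} := by
    ext k
    rw [lp.coeFn_sum, Finset.sum_apply]
    simp
  rw [this, map_sum]
  exact Finset.sum_eq_zero fun n _ => hf n

theorem map_indicatorSeq_diff (f : ℓ∞ →L[ℂ] ℂ) (hf : ∀ n, f (indicatorSeq {n}) = 0)
    (S : Set ℕ) {F : Set ℕ} (hF : F.Finite) : f (indicatorSeq (S \ F)) = f (indicatorSeq S) := by
  have : indicatorSeq S = indicatorSeq (S \ F) + indicatorSeq (S ∩ F) := by
    ext k
    by_cases h1 : k ∈ S <;> by_cases h2 : k ∈ F <;> simp [h1, h2]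
  rw [this, map_add, map_indicatorSeq_finset f hf (hF.inter_of_right S), add_zero]

theorem norm_sum_smul_indicatorSeq_le {ι : Type*} (t : Finset ι) (S : ι → Set ℕ)
    (hS : ∀ i ∈ t, ∀ j ∈ t, i ≠ j → Disjoint (S i) (S j)) (σ : ι → ℂ) (hσ : ∀ i, ‖σ i‖ ≤ 1) :
    ‖∑ i ∈ t, σ i • indicatorSeq (S i)‖ ≤ 1 := by
  refine lp.norm_le_of_forall_le zero_le_one fun k => ?_
  rw [lp.coeFn_sum, Finset.sum_apply]
  by_cases h : ∃ i ∈ t, k ∈ S i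
  · obtain ⟨i, hi, hk⟩ := h
    rw [Finset.sum_eq_single_of_mem i hi]
    · simpa [hk] using hσ i
    · intro j hj hji
      have : k ∉ S j := fun hkj => Set.disjoint_left.1 (hS j hj i hi hji) hkj hk
      simp [this]
  · push Not at h
    rw [Finset.sum_eq_zero]
    · simp
    · intro i hi
      simp [h i hi]

/-- A functional on `ℓ∞` that vanishes on the unit vectors has a bounded sum of absolute values on
the indicators of an almost disjoint family. -/
theorem sum_norm_map_indicatorSeq_le {ι : Type*} (f : ℓ∞ →L[ℂ] ℂ)
    (hf : ∀ n, f (indicatorSeq {n}) = 0) (S : ι → Set ℕ)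
    (hS : ∀ i j, i ≠ j → (S i ∩ S j).Finite) (t : Finset ι) :
    ∑ i ∈ t, ‖f (indicatorSeq (S i))‖ ≤ ‖f‖ := by
  classical
  -- Deleting the finitely many points of overlap makes the sets disjoint without changing the
  -- values of f.
  let F : Set ℕ := ⋃ p ∈ t.offDiag, S p.1 ∩ S p.2
  have hF : F.Finite := t.offDiag.finite_toSet.biUnion fun p hp =>
    hS _ _ (Finset.mem_offDiag.1 (Finset.mem_coe.1 hp)).2.2
  have hdisj : ∀ i ∈ t, ∀ j ∈ t, i ≠ j → Disjoint (S i \ F) (S j \ F) := by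
    intro i hi j hj hij
    refine Set.disjoint_left.2 fun k hki hkj => hki.2 ?_
    exact Set.mem_biUnion (x := (i, j)) (Finset.mem_coe.2 (Finset.mem_offDiag.2 ⟨hi, hj, hij⟩))
      ⟨hki.1, hkj.1⟩
  have hσ : ∀ z : ℂ, ∃ σ : ℂ, ‖σ‖ ≤ 1 ∧ σ * z = ‖z‖ := fun z => by
    by_cases hz : z = 0
    · exact ⟨0, by simp, by simp [hz]⟩
    · have hz' : (‖z‖ : ℂ) ≠ 0 := by simpa using hz
      refine ⟨‖z‖ / z, by simp [hz], div_mul_cancel₀ _ hz⟩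
  choose σ hσ1 hσ2 using hσ
  have h1 := f.le_opNorm (∑ i ∈ t, σ (f (indicatorSeq (S i))) • indicatorSeq (S i \ F))
  have h2 := norm_sum_smul_indicatorSeq_le t (fun i => S i \ F) hdisj
    (fun i => σ (f (indicatorSeq (S i)))) fun i => hσ1 _
  have h3 : f (∑ i ∈ t, σ (f (indicatorSeq (S i))) • indicatorSeq (S i \ F)) =
      ((∑ i ∈ t, ‖f (indicatorSeq (S i))‖ : ℝ) : ℂ) := by
    rw [map_sum]
    push_cast
    refine Finset.sum_congr rfl fun i _ => ?_
    rw [map_smul, map_indicatorSeq_diff f hf _ hF, smul_eq_mul, hσ2]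
  rw [h3, Complex.norm_real, Real.norm_of_nonneg (Finset.sum_nonneg fun i _ => norm_nonneg _)] at h1
  exact h1.trans (mul_le_of_le_one_right (norm_nonneg _) h2)

theorem countable_map_indicatorSeq_ne_zero {ι : Type*} (f : ℓ∞ →L[ℂ] ℂ)
    (hf : ∀ n, f (indicatorSeq {n}) = 0) (S : ι → Set ℕ)
    (hS : ∀ i j, i ≠ j → (S i ∩ S j).Finite) : {i | f (indicatorSeq (S i)) ≠ 0}.Countable := by
  have hsum : Summable fun i => ‖f (indicatorSeq (S i))‖ :=
    summable_of_sum_le (fun _ => norm_nonneg _) fun t => sum_norm_map_indicatorSeq_le f hf S hS t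
  simpa [Function.support] using hsum.countable_support

/-- There is a sequence of disjointly supported, pairwise orthogonal isotropic unit vectors. -/
theorem exists_isotropic_block_sequence (B : ℓ∞ →ₗ[ℂ] ℓ∞ →ₗ[ℂ] ℂ) (hs : ∀ x y, B x y = B y x) :
    ∃ u : ℕ → ℓ∞, (∀ n, ‖u n‖ = 1) ∧ (∀ n, B (u n) (u n) = 0) ∧
      (∀ m n, m < n → B (u m) (u n) = 0) ∧ ∀ m n k, u m k ≠ 0 → u n k ≠ 0 → m = n := by
  classical
  obtain ⟨u, hu, hr⟩ := exists_seq_of_forall_finset_exists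
    (fun x : ℓ∞ => ‖x‖ = 1 ∧ B x x = 0 ∧ (Function.support x).Finite)
    (fun x y => B x y = 0 ∧ ∀ k, x k ≠ 0 → y k = 0) (by
      intro s hsP
      -- The earlier blocks have finite support, so infinitely many coordinates remain free for the
      -- next one.
      let N : Set ℕ := ⋃ x ∈ s, Function.support (x : ℕ → ℂ)
      have hN : N.Finite := s.finite_toSet.biUnion fun x hx => (hsP x hx).2.2
      have : Infinite (Nᶜ : Set ℕ) := hN.infinite_compl.to_subtype
      let e := Infinite.natEmbedding (Nᶜ : Set ℕ)
      let ι : Fin (s.card + 2) → ℕ := fun i => e i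
      have hι : Function.Injective ι := fun i j h =>
        Fin.ext (e.injective (Subtype.ext h))
      let g : (Fin (s.card + 2) → ℂ) →ₗ[ℂ] ℓ∞ :=
        Fintype.linearCombination ℂ fun i => indicatorSeq {ι i}
      have hg : ∀ c k, g c k = ∑ i, if k = ι i then c i else 0 := by
        intro c k
        simp only [g, Fintype.linearCombination_apply, lp.coeFn_sum, Finset.sum_apply]
        simp
      have hg1 : ∀ c i, g c (ι i) = c i := by
        intro c i
        rw [hg, Finset.sum_eq_single i] <;> simp +contextual [hι.eq_iff, eq_comm]
      have hg0 : ∀ c k, g c k ≠ 0 → k ∈ Set.range ι := by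
        intro c k h
        by_contra hk
        refine h ?_
        rw [hg]
        exact Finset.sum_eq_zero fun i _ => if_neg fun hki => hk ⟨i, hki.symm⟩
      obtain ⟨c, hc, hiso, horth⟩ := exists_isotropic_in_span B hs s g
      have hgc : g c ≠ 0 := by
        intro h
        refine hc (funext fun i => ?_)
        rw [← hg1 c i, h]
        simp
      have hnorm : (‖g c‖ : ℂ) ≠ 0 := by simpa using hgc
      refine ⟨(‖g c‖ : ℂ)⁻¹ • g c, ⟨?_, ?_, ?_⟩, fun x hx => ⟨?_, fun k hk => ?_⟩⟩
      · rw [norm_smul, norm_inv, Complex.norm_real, norm_norm,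
          inv_mul_cancel₀ (norm_ne_zero_iff.2 hgc)]
      · simp [hiso]
      · refine (Set.finite_range ι).subset fun k hk => hg0 c k fun h => hk ?_
        simp [h]
      · simp [horth x hx]
      · by_contra h
        obtain ⟨i, rfl⟩ := hg0 c k fun h' => h (by simp [h'])
        exact (e i).2 (Set.mem_biUnion hx hk))
  refine ⟨u, fun n => (hu n).1, fun n => (hu n).2.1, fun m n h => (hr m n h).1, fun m n k hm hn => ?_⟩
  rcases lt_trichotomy m n with h | h | h
  · exact absurd ((hr m n h).2 k hm) hn
  · exact h
  · exact absurd ((hr n m h).2 k hn) hm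

/-- A disjointly supported sequence of unit vectors of `ℓ∞` is the image of the unit vectors under
an operator that keeps the indicators of distinct sets apart. -/
theorem exists_block_embedding (u : ℕ → ℓ∞) (hu : ∀ n, ‖u n‖ = 1)
    (hdisj : ∀ m n k, u m k ≠ 0 → u n k ≠ 0 → m = n) :
    ∃ J : ℓ∞ →L[ℂ] ℓ∞, (∀ n, J (indicatorSeq {n}) = u n) ∧
      ∀ S T : Set ℕ, S ≠ T → 1 / 2 ≤ dist (J (indicatorSeq S)) (J (indicatorSeq T)) := by
  classical
  -- π k is the index of the only block that is non-zero at k. The default 0 is harmless: the weight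
  -- u 0 k is zero there.
  let π : ℕ → ℕ := fun k => if h : ∃ n, u n k ≠ 0 then h.choose else 0
  have hπ : ∀ n k, u n k ≠ 0 → π k = n := by
    intro n k hn
    have h : ∃ n, u n k ≠ 0 := ⟨n, hn⟩
    simp only [π, dif_pos h]
    exact hdisj _ _ k h.choose_spec hn
  refine ⟨weightedComp (fun k => u (π k) k)
    (fun k => (lp.norm_apply_le_norm ENNReal.top_ne_zero (u (π k)) k).trans_eq (hu _)) π, ?_, ?_⟩
  · intro n
    ext k
    by_cases hk : π k = n
    · simp [hk]
    · have : u n k = 0 := by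
        by_contra h
        exact hk (hπ n k h)
      simp [hk, this]
  · intro S T hST
    obtain ⟨n, hn⟩ : ∃ n, ¬ (n ∈ S ↔ n ∈ T) := by
      by_contra! h
      exact hST (Set.ext h)
    obtain ⟨k, hk⟩ : ∃ k, 1 / 2 < ‖u n k‖ := by
      by_contra! h
      have := lp.norm_le_of_forall_le (f := u n) (by norm_num : (0 : ℝ) ≤ 1 / 2) h
      rw [hu n] at this
      norm_num at this
    have hkn : π k = n := hπ n k fun h => by
      rw [h, norm_zero] at hk
      norm_num at hk
    rw [dist_eq_norm]
    refine hk.le.trans (le_trans ?_ (lp.norm_apply_le_norm ENNReal.top_ne_zero _ k))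
    by_cases h1 : n ∈ S <;> by_cases h2 : n ∈ T <;> simp_all

theorem exists_nonseparable_maximal_isotropic (B : ℓ∞ →ₗ[ℂ] ℓ∞ →ₗ[ℂ] ℂ)
    (hs : ∀ x y, B x y = B y x) (hc : ∀ x, Continuous (B x)) :
    ∃ M : Submodule ℂ ℓ∞, (∀ x ∈ M, B x x = 0) ∧
      (∀ M₁ : Submodule ℂ ℓ∞, (∀ x ∈ M₁, B x x = 0) → M ≤ M₁ → M₁ = M) ∧
      ¬ SeparableSpace M := by
  obtain ⟨u, hu1, hu0, huo, hdisj⟩ := exists_isotropic_block_sequence B hs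
  obtain ⟨J, hJ, hJsep⟩ := exists_block_embedding u hu1 hdisj
  obtain ⟨M, hle, hM, hmax⟩ := exists_maximal_isotropic B _ (isotropic_span_range B hs u hu0 huo)
  refine ⟨M, hM, hmax, fun hsep => ?_⟩
  obtain ⟨D, hDc, hDd⟩ := exists_countable_dense M
  let f : ℓ∞ → ℓ∞ →L[ℂ] ℂ := fun x => ⟨B x, hc x⟩
  have hbad : (⋃ d ∈ D, {i | ((f d).comp J) (indicatorSeq (branch i)) ≠ 0}).Countable :=
    hDc.biUnion fun d _ => countable_map_indicatorSeq_ne_zero _ (fun n => by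
      rw [ContinuousLinearMap.comp_apply, hJ]
      exact bilin_eq_zero_of_isotropic B hs hM d.2 (hle (Submodule.subset_span ⟨n, rfl⟩)))
      branch fun _ _ => branch_inter_finite
  set G : Set (ℕ → Bool) := (⋃ d ∈ D, {i | ((f d).comp J) (indicatorSeq (branch i)) ≠ 0})ᶜ with hG
  have horth : ∀ i ∈ G, ∀ m ∈ M, B m (J (indicatorSeq (branch i))) = 0 := by
    intro i hi m hm
    -- Symmetry and continuity in one variable suffice to pass from D to M.
    have hclosed : IsClosed {x : M | B x (J (indicatorSeq (branch i))) = 0} := by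
      simp only [hs _ (J (indicatorSeq (branch i)))]
      exact isClosed_eq ((hc _).comp continuous_subtype_val) continuous_const
    have hsub : D ⊆ {x : M | B x (J (indicatorSeq (branch i))) = 0} := by
      intro d hd
      by_contra h
      exact hi (Set.mem_biUnion hd h)
    have := hclosed.closure_subset_iff.2 hsub (hDd.closure_eq ▸ Set.mem_univ (⟨m, hm⟩ : M))
    exact this
  obtain ⟨u₀, hu₀⟩ := exists_orthogonal_subset_span B hs hM hmax
  have hsepspan : IsSeparable ((M ⊔ Submodule.span ℂ {u₀} : Submodule ℂ ℓ∞) : Set ℓ∞) := by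
    have h1 : IsSeparable ((M : Set ℓ∞) ∪ {u₀}) :=
      (IsSeparable.of_subtype (M : Set ℓ∞)).union (Set.countable_singleton u₀).isSeparable
    have h2 := h1.span (R := ℂ)
    rwa [Submodule.span_union, Submodule.span_eq] at h2
  have hbranch : ∀ i j, i ≠ j → branch i ≠ branch j := fun i j hij h => by
    have := branch_inter_finite hij
    rw [← h, Set.inter_self] at this
    exact branch_infinite i this
  have hGc : G.Countable := Set.Countable.of_separated_of_isSeparable hsepspan
    (fun i => J (indicatorSeq (branch i))) (fun i hi => hu₀ _ (horth i hi)) one_half_pos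
    fun i _ j _ hij => hJsep _ _ (hbranch i j hij)
  have huniv := hbad.union hGc
  rw [hG, Set.union_compl_self] at huniv
  exact not_countable_binary_sequences huniv

end BoundedSequences

/-! ### Polarization and conclusion -/

/-- A continuous `2`-homogeneous polynomial is the quadratic form of a separately continuous
symmetric bilinear form. -/
theorem IsContHomogeneousPolynomial.exists_bilin {X : Type*} [NormedAddCommGroup X]
    [NormedSpace ℂ X] {P : X → ℂ} (hP : IsContHomogeneousPolynomial (𝕜 := ℂ) 2 P) :
    ∃ B : X →ₗ[ℂ] X →ₗ[ℂ] ℂ, (∀ x y, B x y = B y x) ∧ (∀ x, Continuous (B x)) ∧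
      ∀ x, P x = B x x := by
  obtain ⟨⟨A, hsymm, hPA⟩, k, hk⟩ := hP
  have hs : ∀ x y : X, A ![x, y] = A ![y, x] := by
    intro x y
    rw [← hsymm (Equiv.swap 0 1) ![y, x]]
    congr 1
    ext i
    fin_cases i <;> simp
  have hadd : ∀ x y z : X, A ![x + y, z] = A ![x, z] + A ![y, z] := fun x y z =>
    A.cons_add ![z] x y
  have hsmul : ∀ (c : ℂ) (x z : X), A ![c • x, z] = c • A ![x, z] := fun c x z =>
    A.cons_smul ![z] c x
  let B : X →ₗ[ℂ] X →ₗ[ℂ] ℂ := LinearMap.mk₂ ℂ (fun x y => A ![x, y]) hadd hsmul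
    (fun x y z => by rw [hs, hadd, hs y, hs z]) (fun c x y => by rw [hs, hsmul, hs y])
  have hB : ∀ x y, B x y = B y x := hs
  have hPB : ∀ x, P x = B x x := fun x => by
    rw [hPA]
    change A _ = A _
    congr 1
    ext i
    fin_cases i <;> rfl
  refine ⟨B, hB, fun x => ?_, hPB⟩
  have hpol : ∀ y, B x y = (P (x + y) - P (x - y)) / 4 := by
    intro y
    simp only [hPB, map_add, map_sub, LinearMap.add_apply, LinearMap.sub_apply, hB y x]
    ring
  have hk' : ∀ z, ‖P z‖ ≤ |k| * ‖z‖ ^ 2 := fun z =>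
    (hk z).trans (mul_le_mul_of_nonneg_right (le_abs_self k) (by positivity))
  refine (LinearMap.mkContinuousOfExistsBound (B x) ?_).continuous
  -- For y in the unit ball, ‖x ± y‖ ≤ ‖x‖ + 1, so polarization bounds B x y; scaling gives all
  -- other y.
  refine ⟨|k| * (‖x‖ + 1) ^ 2, fun y => ?_⟩
  have hball : ∀ y, ‖y‖ ≤ 1 → ‖B x y‖ ≤ |k| * (‖x‖ + 1) ^ 2 := by
    intro y hy
    have h1 : ‖P (x + y)‖ ≤ |k| * (‖x‖ + 1) ^ 2 := (hk' _).trans (by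
      gcongr
      exact (norm_add_le x y).trans (by linarith))
    have h2 : ‖P (x - y)‖ ≤ |k| * (‖x‖ + 1) ^ 2 := (hk' _).trans (by
      gcongr
      exact (norm_sub_le x y).trans (by linarith))
    have h3 := norm_sub_le (P (x + y)) (P (x - y))
    have h4 : 0 ≤ |k| * (‖x‖ + 1) ^ 2 := by positivity
    rw [hpol, norm_div, Complex.norm_ofNat]
    linarith
  by_cases hy : y = 0
  · simp [hy]
  · have hy' : ‖y‖ ≠ 0 := norm_ne_zero_iff.2 hy
    have h := hball ((‖y‖ : ℂ)⁻¹ • y) (by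
      rw [norm_smul, norm_inv, Complex.norm_real, norm_norm, inv_mul_cancel₀ hy'])
    rw [map_smul, norm_smul, norm_inv, Complex.norm_real, norm_norm] at h
    rwa [inv_mul_le_iff₀ (norm_pos_iff.2 hy), mul_comm] at h

theorem theorem20 (P : lp (fun _ : ℕ => ℂ) ∞ → ℂ)
    (hP : IsContHomogeneousPolynomial (𝕜 := ℂ) 2 P) (hP0 : P ≠ 0) :
    ∃ M : Submodule ℂ (lp (fun _ : ℕ => ℂ) ∞),
      IsPMaximal P M ∧ ¬ TopologicalSpace.SeparableSpace M := by
  obtain ⟨B, hs, hc, hPB⟩ := hP.exists_bilin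
  obtain rfl : P = fun x => B x x := funext hPB
  obtain ⟨M, hM, hmax, hsep⟩ := exists_nonseparable_maximal_isotropic B hs hc
  exact ⟨M, ⟨fun h => hP0 (funext fun x => hM x (h ▸ Submodule.mem_top)), hM, hmax⟩, hsep⟩
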